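/- Let $G$ be a finite simple graph with no connected components of order less than $3$. For an Abelian group $\mathcal{G}$ (written additively) and an edge labelling $f:E(G)\to\mathcal{G}$, put $w(v)=\sum_{e\ni v} f(e)$ for every vertex $v$, and call $f$ vertex-$\mathcal{G}$-colouring if $w(u)\neq w(v)$ whenever $u$ and $v$ are adjacent. Let $\chi^\Sigma_g(G)$ denote the smallest positive integer $s$ such that for every Abelian group $\mathcal{G}$ of order $s$ there exists a vertex-$\mathcal{G}$-colouring edge labelling of $G$. Then for every integer $h\geq\chi^\Sigma_g(G)$ and every Abelian group $\mathcal{G}$ of order $h$, there exists a vertex-$\mathcal{G}$-colouring edge labelling of $G$ if and only if it is not the case that both $\mathcal{G}\cong(\mathbb{Z}_2)^q$ for some integer $q\geq 1$ and $G$ has a connected component isomorphic to the complete graph $K_{h-2}$. -/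

import Mathlib

namespace SimpleGraph

open Classical in
/-- The weighted degree of `v` under an edge labelling `f`: the sum of the labels of the edges
incident with `v`. -/
noncomputable def weightedDegree {V : Type*} [Fintype V] (G : SimpleGraph V)
    {A : Type*} [AddCommGroup A] (f : G.edgeSet → A) (v : V) : A :=
  ∑ e ∈ Finset.univ.filter (fun e : G.edgeSet => v ∈ e.1), f e

/-- An edge labelling with values in `A` is vertex-`A`-colouring if adjacent vertices have
distinct weighted degrees. -/
def IsVertexColouring {V : Type*} [Fintype V] (G : SimpleGraph V)
    {A : Type*} [AddCommGroup A] (f : G.edgeSet → A) : Prop :=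
  ∀ u v : V, G.Adj u v → G.weightedDegree f u ≠ G.weightedDegree f v

/-- The group sum chromatic number: the smallest positive integer `s` such that for every Abelian
group of order `s` there is a vertex-colouring edge labelling of `G` with values in that group.
(Every finite group is isomorphic to one in `Type`, so the quantification over `Type` loses
nothing; `0 < s` makes `Nat.card A = s` say that `A` is finite of order `s`.) -/
noncomputable def groupSumChromaticNumber {V : Type*} [Fintype V] (G : SimpleGraph V) : ℕ :=
  sInf {s : ℕ | 0 < s ∧ ∀ (A : Type) [AddCommGroup A], Nat.card A = s →
    ∃ f : G.edgeSet → A, G.IsVertexColouring f}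

end SimpleGraph

/-! ### Subsets of prescribed size with even sum -/

/-! Weights of a vertex-colouring labelling form a proper colouring, so for `h` above the group sum
chromatic number `G` has a proper colouring by `A` with a colour to spare. On each component it must
be turned into a proper colouring that is realisable as weights: equal sums on the two sides suffice
in the bipartite case, a sum in `2A` otherwise (`mem_edgeWeights_of_signed_sum`,
`mem_edgeWeights_of_even_sum`).

Modulo `2A` only the `m` colours used an odd number of times contribute to the sum, and colours may
be permuted, so an `m`-element subset of `A` with sum in `2A` is enough. For `m < |A|` one exists
unless `A` is an elementary 2-group and `m` is `2` or `|A| - 2`; there the spare colour or a merger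
of two classes changes `m`, except for `K_{|A|-2}` (`exists_coloring_even_sum`).

Conversely, in an elementary 2-group the weights on a component sum to zero, as do all elements of
`A`; on `K_{h-2}` the two unused elements would then be equal. When `h` is the group sum chromatic
number, its definition supplies the labelling. -/

lemma nsmul_eq_zero_of_even_of_add_self {A : Type*} [AddMonoid A] (h2 : ∀ a : A, a + a = 0)
    {k : ℕ} (hk : Even k) (d : A) : k • d = 0 := by
  obtain ⟨r, rfl⟩ := hk
  rw [add_nsmul, h2]

namespace Finset

variable {A : Type*} [AddCommGroup A] [DecidableEq A]

/-- If no set of size `m` has even sum, then every set `S` of size `m` is closed under adding any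
element of `-∑ S + 2A`. -/
lemma add_mem_of_forall_not_even {m : ℕ} (hP : ∀ S : Finset A, #S = m → ¬ Even (∑ x ∈ S, x))
    {S : Finset A} (hS : #S = m) {x d : A} (hx : x ∈ S) (hd : Even (∑ x ∈ S, x + d)) :
    x + d ∈ S := by
  by_contra hy
  have hy' : x + d ∉ S.erase x := fun h => hy (mem_of_mem_erase h)
  refine hP (insert (x + d) (S.erase x)) ?_ ?_
  · rw [card_insert_of_notMem hy', card_erase_add_one hx, hS]
  · rw [sum_insert hy', ← sum_erase_add S _ hx] at *
    convert hd using 1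
    abel

/-- If no set of size `m` has even sum, then every set of size `m` is closed under adding
elements of `2A`. -/
lemma add_add_mem_of_forall_not_even {m : ℕ}
    (hP : ∀ S : Finset A, #S = m → ¬ Even (∑ x ∈ S, x))
    {S : Finset A} (hS : #S = m) {x : A} (z : A) (hx : x ∈ S) : x + (z + z) ∈ S := by
  have h1 := add_mem_of_forall_not_even hP hS hx (d := -∑ x ∈ S, x) (by simp)
  have h2 := add_mem_of_forall_not_even hP hS h1 (d := ∑ x ∈ S, x + (z + z))
    ⟨∑ x ∈ S, x + z, by abel⟩
  convert h2 using 1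
  abel

/-- Otherwise all `m`-sets are closed under translation by `z + z ≠ 0`. Exchanging some `x ∈ S` for
`y ∉ S` forces `y + (z + z) ∈ S`, and translating back gives `y ∈ S`. -/
lemma exists_card_eq_even_sum_of_add_self_ne_zero [Fintype A] {m : ℕ} (hm : m < Fintype.card A)
    {z : A} (hz : z + z ≠ 0) : ∃ S : Finset A, #S = m ∧ Even (∑ x ∈ S, x) := by
  by_contra! hP
  obtain ⟨S, -, hS⟩ := exists_subset_card_eq (s := (univ : Finset A)) (n := m)
    (by simpa using hm.le)
  obtain rfl | ⟨x, hx⟩ := S.eq_empty_or_nonempty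
  · exact hP ∅ hS (by simp)
  obtain ⟨y, hy⟩ : ∃ y, y ∉ S := by
    by_contra! h
    rw [← hS, eq_univ_iff_forall.2 h, card_univ] at hm
    exact hm.false
  have hyx : y ∉ S.erase x := fun h => hy (mem_of_mem_erase h)
  have hS' : #(insert y (S.erase x)) = m := by
    rw [card_insert_of_notMem hyx, card_erase_add_one hx, hS]
  have h1 := add_add_mem_of_forall_not_even hP hS' z (mem_insert_self y _)
  obtain h1 | h1 := mem_insert.1 h1
  · exact hz (by simpa using h1)
  · have h2 := add_add_mem_of_forall_not_even hP hS (-z) (mem_of_mem_erase h1)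
    exact hy (by convert h2 using 1; abel)

/-- In a group of exponent two, a finite set closed under translation by `d ≠ 0` is a union of
pairs `{x, x + d}`. -/
lemma exists_card_eq_two_mul_sum_eq_nsmul (h2 : ∀ a : A, a + a = 0) {d : A} (hd : d ≠ 0)
    (S : Finset A) (hS : ∀ x ∈ S, x + d ∈ S) : ∃ k, #S = 2 * k ∧ ∑ x ∈ S, x = k • d := by
  induction S using Finset.strongInduction with
  | H S ih =>
    obtain rfl | ⟨x, hx⟩ := S.eq_empty_or_nonempty
    · exact ⟨0, by simp⟩
    have hne : x + d ≠ x := by simpa using hd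
    have hxd : x + d ∈ S.erase x := mem_erase.2 ⟨hne, hS x hx⟩
    have hlt : (S.erase x).erase (x + d) ⊂ S :=
      (erase_subset _ _).trans_ssubset (erase_ssubset hx)
    obtain ⟨k, hk, hk'⟩ := ih _ hlt (by
      intro y hy
      simp only [mem_erase] at hy ⊢
      refine ⟨fun h => hy.2.1 (add_right_cancel h), fun h => hy.1 ?_, hS y hy.2.2⟩
      rw [← h, add_assoc, h2, add_zero])
    refine ⟨k + 1, ?_, ?_⟩
    · rw [← card_erase_add_one hx, ← card_erase_add_one hxd, hk]
      ring
    · rw [← sum_erase_add S _ hx, ← sum_erase_add _ _ hxd, hk', add_nsmul, one_nsmul,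
        add_assoc, add_right_comm x d x, h2, zero_add]

lemma sum_univ_eq_zero_of_add_self [Fintype A] (h2 : ∀ a : A, a + a = 0)
    (h4 : 4 ∣ Fintype.card A) : ∑ a : A, a = 0 := by
  have : 1 < Fintype.card A := by
    have := Nat.le_of_dvd Fintype.card_pos h4
    omega
  have : Nontrivial A := Fintype.one_lt_card_iff_nontrivial.1 this
  obtain ⟨d, hd⟩ := exists_ne (0 : A)
  obtain ⟨k, hk, hk'⟩ := exists_card_eq_two_mul_sum_eq_nsmul h2 hd univ (by simp)
  rw [hk']
  refine nsmul_eq_zero_of_even_of_add_self h2 ?_ d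
  rw [card_univ] at hk
  rw [Nat.even_iff]
  omega

/-- Here an even sum is a zero sum. In a counterexample each `m`-set is closed under translation by
its own nonzero sum, so `m = 2k` with `k` odd; one well-chosen exchange breaks this closure. -/
lemma exists_card_eq_even_sum_of_add_self_eq_zero [Fintype A] (h2 : ∀ a : A, a + a = 0)
    (h8 : 4 < Fintype.card A → 8 ∣ Fintype.card A) {m : ℕ} (hm : m < Fintype.card A)
    (hm2 : m ≠ 2) (hm2' : m + 2 ≠ Fintype.card A) :
    ∃ S : Finset A, #S = m ∧ Even (∑ x ∈ S, x) := by
  by_contra! hP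
  obtain ⟨S, -, hS⟩ := exists_subset_card_eq (s := (univ : Finset A)) (n := m)
    (by simpa using hm.le)
  set σ := ∑ x ∈ S, x with hσ
  have hσ0 : σ ≠ 0 := fun h => hP S hS (by rw [← hσ, h]; exact Even.zero)
  have hcl : ∀ x ∈ S, x + σ ∈ S := fun x hx =>
    add_mem_of_forall_not_even hP hS hx ⟨σ, rfl⟩
  have hcl' : ∀ x, x + σ ∈ S → x ∈ S := fun x hx => by
    have := hcl _ hx
    rwa [add_assoc, h2, add_zero] at this
  obtain ⟨k, hk, hk'⟩ := exists_card_eq_two_mul_sum_eq_nsmul h2 hσ0 S hcl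
  have hkodd : ¬ Even k := fun h => hσ0 (by rw [hσ, hk', nsmul_eq_zero_of_even_of_add_self h2 h])
  rw [Nat.even_iff] at hkodd
  -- Exchanging `x` for `y` changes the sum to `σ + x + y`; closure applied to `z` then puts `y + (x
  -- + z) + σ` in the new set, which these conditions exclude.
  suffices H : ∃ x ∈ S, ∃ z ∈ S, ∃ y ∉ S, x ≠ z ∧ x + z ≠ σ ∧ y + (x + z) ∉ S by
    obtain ⟨x, hx, z, hz, y, hy, hxz, hxzσ, hyd⟩ := H
    have hyx : y ∉ S.erase x := fun h => hy (mem_of_mem_erase h)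
    have hS' : #(insert y (S.erase x)) = m := by
      rw [card_insert_of_notMem hyx, card_erase_add_one hx, hS]
    have hz' : z ∈ insert y (S.erase x) := mem_insert_of_mem (mem_erase.2 ⟨hxz.symm, hz⟩)
    have h1 := add_mem_of_forall_not_even hP hS' hz' ⟨_, rfl⟩
    have hsum : z + ∑ x ∈ insert y (S.erase x), x = y + (x + z) + σ := by
      rw [sum_insert hyx, hσ, ← sum_erase_add S _ hx]
      have := h2 x
      calc _ = y + z + ∑ x ∈ S.erase x, x + 0 := by abel
        _ = _ := by rw [← this]; abel
    rw [hsum] at h1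
    obtain h1 | h1 := mem_insert.1 h1
    · refine hxzσ ?_
      rw [add_assoc] at h1
      have h3 : (x + z) + σ = 0 := by simpa using h1
      rw [← add_zero (x + z), ← h2 σ, ← add_assoc, h3, zero_add]
    · exact hyd (hcl' _ (mem_of_mem_erase h1))
  have hsub : ∀ u v : A, u + (u + v) = v := fun u v => by rw [← add_assoc, h2, zero_add]
  have hthird : ∀ T : Finset A, 3 ≤ #T → ∃ x ∈ T, ∃ z ∈ T, x ≠ z ∧ x + z ≠ σ := by
    intro T hT
    obtain ⟨x, hx⟩ : T.Nonempty := card_pos.1 (by omega)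
    obtain ⟨z, hz, hz'⟩ := exists_mem_notMem_of_card_lt_card (s := {x, x + σ}) (t := T)
      (card_le_two.trans_lt (by omega))
    simp only [mem_insert, mem_singleton, not_or] at hz'
    exact ⟨x, hx, z, hz, fun h => hz'.1 h.symm, fun h => hz'.2 (by rw [← h, hsub])⟩
  have hcardS : ∀ d, #(S.image (· + d)) = m := fun d => by
    rw [card_image_of_injective _ (add_left_injective d), hS]
  rcases lt_trichotomy (2 * m) (Fintype.card A) with hlt | heq | hgt
  · obtain ⟨x, hx, z, hz, hxz, hxzσ⟩ := hthird S (by omega)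
    obtain ⟨y, -, hy⟩ := exists_mem_notMem_of_card_lt_card
      (s := S ∪ S.image (· + (x + z))) (t := univ)
      ((card_union_le _ _).trans_lt (by rw [hcardS, card_univ]; omega))
    simp only [mem_union, mem_image, not_or, not_exists, not_and] at hy
    refine ⟨x, hx, z, hz, y, hy.1, hxz, hxzσ, fun h => hy.2 _ h ?_⟩
    rw [add_assoc, h2, add_zero]
  -- Here `|A| = 4k` with `k` odd, and `|A| > 4` because `m ≠ 2`.
  · have := h8 (by omega)
    omega
  · have hc : #Sᶜ = Fintype.card A - m := by rw [card_compl, hS]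
    obtain ⟨y, hy, y', hy', hyy, hyyσ⟩ := hthird Sᶜ (by
      rcases Nat.lt_or_ge 4 (Fintype.card A) with h | h
      · have := h8 h
        omega
      · omega)
    rw [mem_compl] at hy hy'
    -- As `2m > |A|`, `S` meets its translate by `y + y'`; this yields `x, z ∈ S` with `x + z = y +
    -- y'`, hence `y + (x + z) = y' ∉ S`.
    obtain ⟨z, hz⟩ : (S ∩ S.image (· + (y + y'))).Nonempty := by
      rw [← card_pos]
      have h1 := card_union_add_card_inter S (S.image (· + (y + y')))
      have h3 := card_le_univ (S ∪ S.image (· + (y + y')))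
      rw [hcardS] at h1
      omega
    obtain ⟨hzS, hz⟩ := mem_inter.1 hz
    obtain ⟨x, hx, rfl⟩ := mem_image.1 hz
    refine ⟨x, hx, _, hzS, y, hy, ?_, ?_, ?_⟩
    · intro h
      have h3 : y + y' = 0 := by simpa using h.symm
      exact hyy (by rw [← add_zero y, ← h2 y', ← add_assoc, h3, zero_add])
    · rwa [hsub]
    · rwa [hsub, hsub]

end Finset

/-! ### Colourings with even sum -/

section ElementaryTwoGroup

variable {A : Type*} [AddCommGroup A] [Finite A]

lemma exists_addEquiv_zmod_two_of_add_self (h2 : ∀ a : A, a + a = 0) :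
    ∃ q : ℕ, Nonempty (A ≃+ (Fin q → ZMod 2)) := by
  let _ : Module (ZMod 2) A := AddCommGroup.zmodModule (n := 2) (fun x => by rw [two_nsmul, h2])
  exact ⟨_, ⟨(Module.finBasis (ZMod 2) A).equivFun.toAddEquiv⟩⟩

lemma card_eq_two_pow_of_addEquiv {A : Type*} [AddCommGroup A] {q : ℕ}
    (e : A ≃+ (Fin q → ZMod 2)) : Nat.card A = 2 ^ q := by
  rw [Nat.card_congr e.toEquiv]
  simp

lemma add_self_of_addEquiv {A : Type*} [AddCommGroup A] {q : ℕ}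
    (e : A ≃+ (Fin q → ZMod 2)) (a : A) : a + a = 0 := by
  apply e.injective
  rw [map_add, map_zero]
  funext i
  exact CharTwo.add_self_eq_zero _

lemma eight_dvd_two_pow {q : ℕ} (h : 4 < 2 ^ q) : 8 ∣ 2 ^ q := by
  have : 2 < q := by
    by_contra! hq
    have := Nat.pow_le_pow_right (n := 2) (by norm_num) hq
    omega
  exact pow_dvd_pow 2 this

end ElementaryTwoGroup

open Finset in
lemma Finset.exists_perm_map_eq {A : Type*} [Fintype A] [DecidableEq A] {S T : Finset A}
    (h : #S = #T) : ∃ e : Equiv.Perm A, S.map e.toEmbedding = T := by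
  let e : {x // x ∈ S} ≃ {x // x ∈ T} := Finset.equivOfCardEq h
  refine ⟨e.extendSubtype, eq_of_subset_of_card_le (fun a ha => ?_) (by simp [h])⟩
  obtain ⟨b, hb, rfl⟩ := mem_map.1 ha
  exact e.extendSubtype_mem b hb

namespace SimpleGraph

open Finset Function

variable {W A : Type*} [Fintype W] [Fintype A] [DecidableEq A]

/-- The set of colours whose colour class has an odd number of elements. -/
def oddColours (c : W → A) : Finset A := {a | Odd #{v | c v = a}}

lemma mem_oddColours {c : W → A} {a : A} : a ∈ oddColours c ↔ Odd #{v | c v = a} := by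
  simp [oddColours]

lemma exists_mem_range_of_mem_oddColours {c : W → A} {a : A} (h : a ∈ oddColours c) :
    ∃ v, c v = a := by
  obtain ⟨v, hv⟩ := card_pos.1 (mem_oddColours.1 h).pos
  exact ⟨v, by simpa using hv⟩

/-- Parity as a sum in `ZMod 2` makes the effect of a recolouring additive. -/
lemma mem_oddColours_iff_sum {c : W → A} {a : A} :
    a ∈ oddColours c ↔ (∑ v, if c v = a then (1 : ZMod 2) else 0) ≠ 0 := by
  rw [mem_oddColours, sum_boole, Ne, ZMod.natCast_eq_zero_iff_even, Nat.not_even_iff_odd]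

/-- Recolouring `v` with `a` toggles the parity of the two classes involved. -/
lemma mem_oddColours_update [DecidableEq W] {c : W → A} {v : W} {a : A} (hva : c v ≠ a) (b : A) :
    b ∈ oddColours (update c v a) ↔ (b ∈ oddColours c ↔ (b ≠ c v ∧ b ≠ a)) := by
  have key : (∑ w, if update c v a w = b then (1 : ZMod 2) else 0)
      = (∑ w, if c w = b then (1 : ZMod 2) else 0)
        + ((if a = b then 1 else 0) - (if c v = b then 1 else 0)) := by
    rw [← sub_eq_iff_eq_add', ← sum_sub_distrib, sum_eq_single v]
    · simp
    · intro w _ hw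
      simp [hw]
    · simp
  rw [mem_oddColours_iff_sum, mem_oddColours_iff_sum, key]
  generalize (∑ w, if c w = b then (1 : ZMod 2) else 0) = x
  by_cases h1 : a = b
  · have h2 : c v ≠ b := h1 ▸ hva
    simp only [h1, h2, if_true, if_false, ne_eq, not_true, and_false, iff_false]
    clear key
    revert x
    decide
  · by_cases h2 : c v = b
    · simp only [h1, h2, if_true, if_false, ne_eq, not_true, false_and, iff_false]
      clear key
      revert x
      decide
    · simp [h1, h2, Ne.symm h1, Ne.symm h2]

lemma even_sum_of_forall {ι B : Type*} [AddCommMonoid B] (s : Finset ι) (f : ι → B)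
    (h : ∀ i ∈ s, Even (f i)) : Even (∑ i ∈ s, f i) := by
  classical
  exact Finset.sum_induction f Even (fun _ _ => Even.add) Even.zero h

/-- Colours can be permuted to make the sum of all colours even as soon as there is a set of
colours of the right size with even sum. -/
lemma exists_perm_even_sum [AddCommGroup A] (c : W → A) {S : Finset A}
    (hS : #S = #(oddColours c)) (hS' : Even (∑ a ∈ S, a)) :
    ∃ e : Equiv.Perm A, Even (∑ v, e (c v)) := by
  obtain ⟨e, rfl⟩ := exists_perm_map_eq hS.symm
  refine ⟨e, ?_⟩
  have h1 : ∑ v, e (c v) = ∑ a, #{v | c v = a} • e a := by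
    rw [← sum_fiberwise univ c]
    refine sum_congr rfl fun a _ => ?_
    rw [sum_congr rfl (g := fun _ => e a) (by simp +contextual), sum_const]
  have h2 : ∑ a ∈ (oddColours c).map e.toEmbedding, a
      = ∑ a, if a ∈ oddColours c then e a else 0 := by
    simp [sum_map]
  -- Modulo `2A`, a colour counts only through the parity of its multiplicity.
  have h3 : Even (∑ v, e (c v) - ∑ a ∈ (oddColours c).map e.toEmbedding, a) := by
    rw [h1, h2, ← sum_sub_distrib]
    refine even_sum_of_forall _ _ fun a _ => ?_
    split_ifs with h <;> rw [mem_oddColours] at h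
    · obtain ⟨k, hk⟩ := h
      refine ⟨k • e a, ?_⟩
      rw [hk, add_nsmul, one_nsmul, add_sub_cancel_right, two_mul, add_nsmul]
    · rw [Nat.not_odd_iff_even] at h
      obtain ⟨k, hk⟩ := h
      exact ⟨k • e a, by rw [hk, add_nsmul, sub_zero]⟩
  simpa using h3.add hS'

variable {H : SimpleGraph W}

/-- Recolour one vertex with an unused colour. -/
def Coloring.updateFresh [DecidableEq W] (c : H.Coloring A) (v : W) {a : A}
    (ha : ∀ w, c w ≠ a) : H.Coloring A :=
  Coloring.mk (update c v a) fun {x y} hxy => by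
    rcases eq_or_ne x v with rfl | hx
    · rw [update_self, update_of_ne hxy.ne']
      exact (ha y).symm
    · rcases eq_or_ne y v with rfl | hy
      · rw [update_self, update_of_ne hx]
        exact ha x
      · rw [update_of_ne hx, update_of_ne hy]
        exact c.valid hxy

lemma exists_coloring_forall_ne {W : Type*} {H : SimpleGraph W} {A : Type*} [Finite A]
    (hA : 0 < Nat.card A) (hcol : H.Colorable (Nat.card A - 1)) :
    ∃ c : H.Coloring A, ∃ a, ∀ v, c v ≠ a := by
  obtain ⟨c⟩ := hcol
  let e := Finite.equivFin A
  let ι : Fin (Nat.card A - 1) ↪ A :=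
    (Fin.castLEEmb (Nat.sub_le _ 1)).trans e.symm.toEmbedding
  refine ⟨Coloring.mk (fun v => ι (c v)) fun h h' => c.valid h (ι.injective h'),
    e.symm ⟨Nat.card A - 1, by omega⟩, fun v hv => ?_⟩
  have h1 : Fin.castLE (Nat.sub_le _ 1) (c v) = ⟨Nat.card A - 1, by omega⟩ :=
    e.symm.injective hv
  have h3 := congrArg Fin.val h1
  simp only [Fin.val_castLE] at h3
  omega

/-- A graph that is not bipartite and can be coloured with one colour less than the order of `A`
has a proper colouring by elements of `A` with even sum, unless `A` is an elementary abelian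
`2`-group and the graph is complete on `|A| - 2` vertices. -/
theorem exists_coloring_even_sum {A : Type*} [AddCommGroup A] [Finite A]
    (hcol : H.Colorable (Nat.card A - 1)) (hbip : ¬ H.Colorable 2)
    (hex : ¬ ((∃ q : ℕ, 1 ≤ q ∧ Nonempty (A ≃+ (Fin q → ZMod 2))) ∧
      Nonempty (H ≃g (⊤ : SimpleGraph (Fin (Nat.card A - 2)))))) :
    ∃ c : H.Coloring A, Even (∑ v, c v) := by
  classical
  have := Fintype.ofFinite A
  have hn : 4 ≤ Nat.card A := by
    by_contra! h
    exact hbip (hcol.mono (by omega))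
  obtain ⟨c, a, ha⟩ := exists_coloring_forall_ne (by omega) hcol
  rw [Nat.card_eq_fintype_card] at *
  have permute : ∀ c : H.Coloring A, (∃ S : Finset A, #S = #(oddColours c) ∧ Even (∑ a ∈ S, a)) →
      ∃ c : H.Coloring A, Even (∑ v, c v) := by
    rintro c ⟨S, hS, hS'⟩
    obtain ⟨e, he⟩ := exists_perm_even_sum c hS hS'
    exact ⟨Coloring.mk (fun v => e (c v)) fun h h' => c.valid h (e.injective h'), he⟩
  have hodd : oddColours c ⊆ univ.erase a := fun b hb => by
    obtain ⟨v, rfl⟩ := exists_mem_range_of_mem_oddColours hb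
    exact mem_erase.2 ⟨ha v, mem_univ _⟩
  have hlt : #(oddColours c) < Fintype.card A :=
    (card_le_card hodd).trans_lt (card_erase_lt_of_mem (mem_univ a))
  by_cases h2 : ∀ a : A, a + a = 0
  swap
  · obtain ⟨z, hz⟩ := not_forall.1 h2
    exact permute c (exists_card_eq_even_sum_of_add_self_ne_zero hlt hz)
  obtain ⟨q, ⟨eq⟩⟩ := exists_addEquiv_zmod_two_of_add_self h2
  have hq := card_eq_two_pow_of_addEquiv eq
  rw [Nat.card_eq_fintype_card] at hq
  have hq1 : 1 ≤ q := by
    by_contra! h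
    obtain rfl : q = 0 := by omega
    omega
  have h8 : 4 < Fintype.card A → 8 ∣ Fintype.card A := fun h => by
    rw [hq] at h ⊢
    exact eight_dvd_two_pow h
  have h4 : 4 ∣ Fintype.card A := by
    rcases hn.eq_or_lt with h | h
    · rw [← h]
    · exact (by norm_num : 4 ∣ 8).trans (h8 h)
  have finish : ∀ c : H.Coloring A, #(oddColours c) ≠ 2 → #(oddColours c) + 2 ≠ Fintype.card A →
      ∃ c : H.Coloring A, Even (∑ v, c v) := by
    -- The value `m = |A|` is also harmless, since the whole group sums to zero.
    intro c h h'
    rcases (card_le_univ (oddColours c)).eq_or_lt with hu | hu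
    · exact permute c ⟨univ, by rw [hu, card_univ],
        by rw [sum_univ_eq_zero_of_add_self h2 h4]; exact Even.zero⟩
    · exact permute c (exists_card_eq_even_sum_of_add_self_eq_zero h2 h8 hu h h')
  by_cases hm : #(oddColours c) ≠ 2 ∧ #(oddColours c) + 2 ≠ Fintype.card A
  · exact finish c hm.1 hm.2
  have split : ∀ (c : H.Coloring A) (v : W) (a : A) (ha : ∀ w, c w ≠ a), c v ∉ oddColours c →
      #(oddColours (c.updateFresh v ha)) = #(oddColours c) + 2 := by
    intro c v a ha hv
    have ha' : a ∉ oddColours c := fun h => by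
      obtain ⟨w, hw⟩ := exists_mem_range_of_mem_oddColours h
      exact ha w hw
    rw [← card_pair (ha v), ← card_union_of_disjoint]
    · congr 1
      ext b
      rw [show (c.updateFresh v ha : W → A) = update c v a from rfl,
        mem_oddColours_update (ha v), mem_union, mem_insert, mem_singleton]
      by_cases h1 : b = c v
      · simp [h1, hv]
      · by_cases h3 : b = a
        · simp [h3, ha']
        · simp [h1, h3]
    · simp [hv, ha']
  -- Giving the spare colour to a vertex of an even class moves `m` from `2` or `|A| - 2` to `4` or
  -- `|A|`; `4 = |A| - 2` is impossible as `|A|` is `4` or a multiple of `8`.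
  by_cases hall : ∃ v, c v ∉ oddColours c
  · obtain ⟨v, hv⟩ := hall
    refine finish (c.updateFresh v ha) ?_ ?_ <;> rw [split c v a ha hv]
    · have : #(oddColours c) ≠ 0 := by omega
      omega
    · intro h
      rcases hn.eq_or_lt with h' | h'
      · omega
      · have := h8 h'
        omega
  push Not at hall
  have hm2 : #(oddColours c) ≠ 2 := fun h => hbip <| by
    let c' : H.Coloring (oddColours c) := Coloring.mk (fun v => ⟨c v, hall v⟩)
      fun h h' => c.valid h (congrArg Subtype.val h')
    have := c'.colorable
    rwa [Fintype.card_coe, h] at this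
  have hm' : #(oddColours c) + 2 = Fintype.card A := by
    by_contra h
    exact hm ⟨hm2, h⟩
  have h8' := h8 (by omega)
  by_cases hinj : Injective c
  · have hcard : Fintype.card W = Fintype.card A - 2 := by
      have : univ.image c = oddColours c := by
        ext b
        simp only [mem_image, mem_univ, true_and]
        exact ⟨by rintro ⟨v, rfl⟩; exact hall v, exists_mem_range_of_mem_oddColours⟩
      rw [← card_univ, ← card_image_of_injective univ hinj, this]
      omega
    by_cases htop : H = ⊤
    · subst htop
      exact absurd ⟨⟨q, hq1, ⟨eq⟩⟩, ⟨Iso.completeGraph (Fintype.equivFinOfCardEq hcard)⟩⟩ hex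
    -- All classes are singletons, so merging two non-adjacent vertices lowers `m` to `|A| - 4`,
    -- which is at least `4`.
    obtain ⟨u, v, huv, hadj⟩ : ∃ u v, u ≠ v ∧ ¬ H.Adj u v := by
      by_contra! h
      exact htop (by ext x y; simpa using ⟨fun h => h.ne, h x y⟩)
    have hcuv : c u ≠ c v := hinj.ne huv
    let c' : H.Coloring A := Coloring.mk (update c u (c v)) fun {x y} hxy => by
      rcases eq_or_ne x u with rfl | hx
      · rw [update_self, update_of_ne hxy.ne']
        exact hinj.ne fun h => hadj (h ▸ hxy)
      · rcases eq_or_ne y u with rfl | hy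
        · rw [update_self, update_of_ne hx]
          exact hinj.ne fun h => hadj (h ▸ hxy.symm)
        · rw [update_of_ne hx, update_of_ne hy]
          exact c.valid hxy
    have hc' : #(oddColours c') + 2 = #(oddColours c) := by
      have : oddColours c' = oddColours c \ {c u, c v} := by
        ext b
        rw [show (c' : W → A) = update c u (c v) from rfl,
          mem_oddColours_update hcuv, mem_sdiff, mem_insert, mem_singleton]
        by_cases h1 : b = c u
        · simp [h1, hall u]
        · by_cases h3 : b = c v
          · simp [h3, hall v]
          · simp [h1, h3]
      rw [this, ← card_pair hcuv]
      exact card_sdiff_add_card_eq_card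
        (insert_subset (hall u) (singleton_subset_iff.2 (hall v)))
    exact finish c' (by omega) (by omega)
  -- Two vertices of one class move to the two unused colours `a` and `b`: the first move preserves
  -- `m`, the second raises it to `|A|`.
  · obtain ⟨u, v, huv, hne⟩ : ∃ u v, c u = c v ∧ u ≠ v := by
      simpa [Injective] using hinj
    obtain ⟨b, hb, hba⟩ : ∃ b, b ∉ oddColours c ∧ b ≠ a := by
      obtain ⟨b, -, hb⟩ := exists_mem_notMem_of_card_lt_card (s := insert a (oddColours c))
        (t := univ) ((card_insert_le _ _).trans_lt (by rw [card_univ]; omega))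
      rw [mem_insert, not_or] at hb
      exact ⟨b, hb.2, hb.1⟩
    have hb' : ∀ w, c w ≠ b := fun w h => hb (h ▸ hall w)
    have hcoe : (c.updateFresh u ha : W → A) = update c u a := rfl
    have hb'' : ∀ w, c.updateFresh u ha w ≠ b := fun w => by
      rw [hcoe, update_apply]
      split_ifs
      exacts [hba.symm, hb' w]
    have hv : c.updateFresh u ha v = c v := by
      rw [hcoe, update_of_ne hne.symm]
    have hv' : c.updateFresh u ha v ∉ oddColours (c.updateFresh u ha) := by
      rw [hv, hcoe, mem_oddColours_update (ha u)]
      simp [hall v, huv]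
    have ha' : a ∉ oddColours c := fun h => by
      obtain ⟨w, hw⟩ := exists_mem_range_of_mem_oddColours h
      exact ha w hw
    have hcard : #(oddColours (c.updateFresh u ha)) = #(oddColours c) := by
      have h1 : oddColours (c.updateFresh u ha) = insert a ((oddColours c).erase (c u)) := by
        ext b
        rw [hcoe, mem_oddColours_update (ha u), mem_insert, mem_erase]
        by_cases h1 : b = c u
        · simp [h1, hall u, ha u]
        · by_cases h3 : b = a
          · simp [h3, ha']
          · simp [h1, h3]
      rw [h1, card_insert_of_notMem (fun h => ha' (mem_of_mem_erase h)),
        card_erase_add_one (hall u)]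
    refine finish ((c.updateFresh u ha).updateFresh v hb'') ?_ ?_ <;>
      rw [split _ v b hb'' hv', hcard] <;> omega

end SimpleGraph

/-! ### Realisable vertex weights -/

namespace SimpleGraph

open Finset

section Realizable

variable {V W A : Type*} [AddCommGroup A]

open Classical in
/-- The weight functions generated by placing a single label on a single edge. -/
noncomputable def edgeWeights (G : SimpleGraph V) (A : Type*) [AddCommGroup A] :
    AddSubgroup (V → A) :=
  AddSubgroup.closure
    {x | ∃ (u v : V) (a : A), G.Adj u v ∧ x = Pi.single u a + Pi.single v a}

lemma weightedDegree_add [Fintype V] (G : SimpleGraph V) (f g : G.edgeSet → A) :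
    G.weightedDegree (f + g) = G.weightedDegree f + G.weightedDegree g := by
  funext v
  simp [weightedDegree, sum_add_distrib]

lemma weightedDegree_neg [Fintype V] (G : SimpleGraph V) (f : G.edgeSet → A) :
    G.weightedDegree (-f) = -G.weightedDegree f := by
  funext v
  simp [weightedDegree]

lemma weightedDegree_zero [Fintype V] (G : SimpleGraph V) :
    G.weightedDegree (0 : G.edgeSet → A) = 0 := by
  funext v
  simp [weightedDegree]

lemma exists_weightedDegree_eq [Fintype V] {G : SimpleGraph V} {x : V → A}
    (hx : x ∈ G.edgeWeights A) : ∃ f : G.edgeSet → A, G.weightedDegree f = x := by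
  classical
  induction hx using AddSubgroup.closure_induction with
  | mem x hx =>
    obtain ⟨u, v, a, h, rfl⟩ := hx
    refine ⟨Pi.single ⟨s(u, v), h⟩ a, ?_⟩
    funext w
    simp only [weightedDegree, sum_filter, Pi.add_apply]
    rw [sum_eq_single ⟨s(u, v), h⟩]
    · rw [Pi.single_eq_same, Pi.single_apply, Pi.single_apply]
      simp only [Sym2.mem_iff]
      have := h.ne
      by_cases h1 : w = u
      · subst h1
        simp [this]
      · simp [h1]
    · intro e _ he
      simp [Pi.single_eq_of_ne he]
    · simp
  | zero => exact ⟨0, weightedDegree_zero G⟩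
  | add x y _ _ hx hy =>
    obtain ⟨f, rfl⟩ := hx
    obtain ⟨g, rfl⟩ := hy
    exact ⟨f + g, weightedDegree_add G f g⟩
  | neg x _ hx =>
    obtain ⟨f, rfl⟩ := hx
    exact ⟨-f, weightedDegree_neg G f⟩

/-- Weight functions push forward along graph homomorphisms. -/
lemma sum_single_mem_edgeWeights [Fintype W] [DecidableEq V] {H : SimpleGraph W}
    {G : SimpleGraph V} (φ : H →g G) {x : W → A} (hx : x ∈ H.edgeWeights A) :
    ∑ w, Pi.single (φ w) (x w) ∈ G.edgeWeights A := by
  classical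
  induction hx using AddSubgroup.closure_induction with
  | mem x hx =>
    obtain ⟨u, v, a, h, rfl⟩ := hx
    have key : ∀ u : W, ∑ w, (Pi.single (φ w) ((Pi.single u a : W → A) w) : V → A)
        = Pi.single (φ u) a := fun u => by
      rw [sum_eq_single u]
      · simp
      · intro w _ hw
        simp [Pi.single_eq_of_ne hw]
      · simp
    simp only [Pi.add_apply, Pi.single_add, sum_add_distrib, key]
    refine AddSubgroup.subset_closure ⟨_, _, a, φ.map_adj h, ?_⟩
    congr!
  | zero => simp [zero_mem]
  | add x y _ _ hx hy =>
    simp only [Pi.add_apply, Pi.single_add, sum_add_distrib]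
    exact add_mem hx hy
  | neg x _ hx =>
    simp only [Pi.neg_apply, Pi.single_neg, sum_neg_distrib]
    exact neg_mem hx

/-- Labels `a, -a, a, …` along the walk cancel at each interior step, so weight can be carried from
one end to the other up to sign. -/
lemma Walk.single_sub_single_mem_edgeWeights [DecidableEq V] {G : SimpleGraph V} {u v : V}
    (p : G.Walk u v) (a : A) :
    Pi.single u a - Pi.single v ((-1 : ℤ) ^ p.length • a) ∈ G.edgeWeights A := by
  induction p with
  | nil => simp [zero_mem]
  | @cons u v w h p ih =>
    have h1 : (Pi.single u a + Pi.single v a : V → A) ∈ G.edgeWeights A :=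
      AddSubgroup.subset_closure ⟨u, v, a, h, by congr!⟩
    convert sub_mem h1 ih using 1
    rw [Walk.length_cons, pow_succ, mul_neg_one, neg_smul, Pi.single_neg]
    abel

variable [Fintype V] {G : SimpleGraph V}

lemma sum_single_eq [DecidableEq V] (c : V → A) : ∑ v, Pi.single v (c v) = c := by
  funext w
  simp [Finset.sum_apply, Pi.single_apply]

/-- In a connected non-bipartite graph every weight function with even sum is realisable. -/
lemma mem_edgeWeights_of_even_sum (hG : G.Connected) (hbip : ¬ G.Colorable 2) {c : V → A}
    (hc : Even (∑ v, c v)) : c ∈ G.edgeWeights A := by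
  classical
  rw [two_colorable_iff_forall_loop_even] at hbip
  push Not at hbip
  obtain ⟨r, p, hp⟩ := hbip
  -- A closed walk of odd length returns `a` with the opposite sign.
  have htwo : ∀ a : A, Pi.single r (a + a) ∈ G.edgeWeights A := fun a => by
    have := p.single_sub_single_mem_edgeWeights a
    rwa [(Nat.not_even_iff_odd.1 hp).neg_one_pow, neg_smul, one_smul, Pi.single_neg,
      sub_neg_eq_add, ← Pi.single_add] at this
  have hmove : ∀ v (a : A), Pi.single v a - Pi.single r a ∈ G.edgeWeights A := fun v a => by
    obtain ⟨q⟩ := hG.preconnected v r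
    have hq := q.single_sub_single_mem_edgeWeights a
    rcases Nat.even_or_odd q.length with h | h
    · rwa [h.neg_one_pow, one_smul] at hq
    · rw [h.neg_one_pow, neg_smul, one_smul] at hq
      convert sub_mem hq (htwo a) using 1
      rw [Pi.single_neg, Pi.single_add]
      abel
  obtain ⟨b, hb⟩ := hc
  have h1 := sum_mem (t := univ) fun v (_ : v ∈ univ) => hmove v (c v)
  have h2 : ∑ v, (Pi.single r (c v) : V → A) = Pi.single r (b + b) := by
    rw [← hb]
    exact (map_sum (AddMonoidHom.single (fun _ : V => A) r) c univ).symm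
  rw [sum_sub_distrib, sum_single_eq, h2] at h1
  simpa using add_mem h1 (htwo b)

/-- In a connected bipartite graph every weight function with the same sum on both sides is
realisable. -/
lemma mem_edgeWeights_of_signed_sum (hG : G.Connected) (κ : G.Coloring Bool) {c : V → A}
    (hc : ∑ v, (if κ v then c v else -c v) = 0) : c ∈ G.edgeWeights A := by
  classical
  obtain ⟨r⟩ := hG.nonempty
  have hmove : ∀ v (a : A), Pi.single v a - Pi.single r (if κ v = κ r then a else -a)
      ∈ G.edgeWeights A := fun v a => by
    obtain ⟨q⟩ := hG.preconnected v r
    have hq := q.single_sub_single_mem_edgeWeights a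
    have hpar := κ.even_length_iff_congr q
    split_ifs with h
    · rwa [(hpar.2 (by rw [h])).neg_one_pow, one_smul] at hq
    · have : Odd q.length := by
        rw [← Nat.not_even_iff_odd, hpar, Bool.coe_iff_coe]
        exact h
      rwa [this.neg_one_pow, neg_smul, one_smul] at hq
  have h1 := sum_mem (t := univ) fun v (_ : v ∈ univ) => hmove v (c v)
  have h2 : ∑ v, (Pi.single r (if κ v = κ r then c v else -c v) : V → A) = 0 := by
    refine (map_sum (AddMonoidHom.single (fun _ : V => A) r) _ univ).symm.trans ?_
    cases hr : κ r
    · have : ∑ v, (if κ v = false then c v else -c v) = -0 := by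
        rw [← hc, ← sum_neg_distrib]
        refine sum_congr rfl fun v _ => ?_
        cases κ v <;> simp
      rw [this]
      simp
    · rw [hc]
      simp
  rwa [sum_sub_distrib, sum_single_eq, h2, sub_zero] at h1

/-- Since `|A| ≥ 3`, a value other than `0` and `t` is available, which leaves a nonzero target for
the remaining indices. -/
lemma exists_ne_zero_sum_eq {ι : Type*} [Finite A] (hA : 3 ≤ Nat.card A) {s : Finset ι}
    (hs : s.Nonempty) {t : A} (ht : t ≠ 0 ∨ 2 ≤ #s) :
    ∃ c : ι → A, (∀ i, c i ≠ 0) ∧ ∑ i ∈ s, c i = t := by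
  classical
  have := Fintype.ofFinite A
  rw [Nat.card_eq_fintype_card] at hA
  induction hs using Finset.Nonempty.cons_induction generalizing t with
  | singleton i =>
    have ht : t ≠ 0 := by simpa using ht
    exact ⟨fun _ => t, fun _ => ht, by simp⟩
  | cons i s hi hs ih =>
    obtain ⟨a, -, ha⟩ := exists_mem_notMem_of_card_lt_card (s := {0, t}) (t := (univ : Finset A))
      (card_le_two.trans_lt (by rw [card_univ]; omega))
    simp only [mem_insert, mem_singleton, not_or] at ha
    obtain ⟨c, hc, hc'⟩ := ih (t := t - a) (.inl (sub_ne_zero.2 (Ne.symm ha.2)))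
    refine ⟨Function.update c i a, fun j => ?_, ?_⟩
    · rw [Function.update_apply]
      split_ifs
      exacts [ha.1, hc j]
    · rw [sum_cons, Function.update_self, sum_update_of_notMem hi, hc']
      abel

/-- A side with at least two vertices gets nonzero colours of sum zero; the other side gets `0`
throughout. -/
lemma exists_coloring_signed_sum_eq_zero [Finite A] (hA : 3 ≤ Nat.card A)
    (hV : 3 ≤ Fintype.card V) (κ : G.Coloring Bool) :
    ∃ c : G.Coloring A, ∑ v, (if κ v then c v else -c v) = 0 := by
  classical
  obtain ⟨b, hb⟩ : ∃ b, 2 ≤ #{v | κ v = b} := by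
    by_contra! h
    have h1 := card_eq_sum_card_fiberwise (s := univ) (t := univ) (f := κ) (by simp)
    rw [Fintype.sum_bool, card_univ] at h1
    have := h true
    have := h false
    omega
  obtain ⟨c, hc, hc'⟩ := exists_ne_zero_sum_eq hA (card_pos.1 (by omega)) (t := 0) (.inr hb)
  refine ⟨Coloring.mk (fun v => if κ v = b then c v else 0) fun {u v} h => ?_, ?_⟩
  · have := κ.valid h
    cases hu : κ u <;> cases hv : κ v <;> cases b <;> simp [hu, hv, hc, Ne.symm (hc _)] at this ⊢
  · rw [sum_filter] at hc'
    change ∑ v, (if κ v then (if κ v = b then c v else 0) else -(if κ v = b then c v else 0)) = 0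
    cases b
    · rw [← neg_eq_zero, ← sum_neg_distrib]
      refine Eq.trans ?_ hc'
      refine sum_congr rfl fun v _ => ?_
      cases κ v <;> simp
    · refine Eq.trans ?_ hc'
      refine sum_congr rfl fun v _ => ?_
      cases κ v <;> simp

lemma Connected.two_le_of_colorable (hG : G.Connected) (hV : 2 ≤ Fintype.card V) {n : ℕ}
    (hn : G.Colorable n) : 2 ≤ n := by
  obtain ⟨u, v, huv⟩ := Fintype.exists_pair_of_one_lt_card hV
  obtain ⟨p⟩ := hG.preconnected u v
  obtain ⟨c⟩ := hn
  cases p with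
  | nil => exact absurd rfl huv
  | @cons _ w _ h _ =>
    have h1 := c.valid h
    have h2 := (c u).isLt
    have h3 := (c w).isLt
    have h4 : (c u : ℕ) ≠ c w := fun h => h1 (Fin.ext h)
    omega

lemma Connected.exists_coloring_mem_edgeWeights [Finite A] (hG : G.Connected)
    (hV : 3 ≤ Fintype.card V) (hcol : G.Colorable (Nat.card A - 1))
    (hex : ¬ ((∃ q : ℕ, 1 ≤ q ∧ Nonempty (A ≃+ (Fin q → ZMod 2))) ∧
      Nonempty (G ≃g (⊤ : SimpleGraph (Fin (Nat.card A - 2)))))) :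
    ∃ c : G.Coloring A, (c : V → A) ∈ G.edgeWeights A := by
  by_cases hbip : G.Colorable 2
  · have := hG.two_le_of_colorable (by omega) hcol
    obtain ⟨c, hc⟩ := exists_coloring_signed_sum_eq_zero (A := A) (by omega) hV
      (hbip.toColoring (by simp))
    exact ⟨c, mem_edgeWeights_of_signed_sum hG _ hc⟩
  · obtain ⟨c, hc⟩ := exists_coloring_even_sum hcol hbip hex
    exact ⟨c, mem_edgeWeights_of_even_sum hG hbip hc⟩

/-- Main existence result: one colour to spare and no exceptional component. -/
theorem exists_isVertexColouring_of_colorable [Finite A]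
    (hG : ∀ C : G.ConnectedComponent, 3 ≤ C.supp.ncard) (hcol : G.Colorable (Nat.card A - 1))
    (hex : ¬ ((∃ q : ℕ, 1 ≤ q ∧ Nonempty (A ≃+ (Fin q → ZMod 2))) ∧
      ∃ C : G.ConnectedComponent,
        Nonempty (C.toSimpleGraph ≃g (⊤ : SimpleGraph (Fin (Nat.card A - 2)))))) :
    ∃ f : G.edgeSet → A, G.IsVertexColouring f := by
  classical
  have key : ∀ C : G.ConnectedComponent, ∃ c : C.toSimpleGraph.Coloring A,
      (c : C → A) ∈ C.toSimpleGraph.edgeWeights A := fun C => by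
    refine C.connected_toSimpleGraph.exists_coloring_mem_edgeWeights ?_
      (hcol.of_hom C.toSimpleGraph_hom) fun h => hex ⟨h.1, C, h.2⟩
    rw [← Nat.card_eq_fintype_card]
    exact hG C
  choose c hc using key
  -- The components have disjoint supports, so their realisable colourings can be added.
  obtain ⟨f, hf⟩ := exists_weightedDegree_eq
    (sum_mem (t := univ) fun C (_ : C ∈ univ) =>
      sum_single_mem_edgeWeights C.toSimpleGraph_hom (hc C))
  have hval : ∀ (C : G.ConnectedComponent) (v : C), G.weightedDegree f v = c C v := by
    rintro C ⟨v, rfl⟩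
    rw [hf, Finset.sum_apply, sum_eq_single (G.connectedComponentMk v)]
    · rw [Finset.sum_apply, sum_eq_single ⟨v, rfl⟩]
      · exact Pi.single_eq_same _ _
      · rintro ⟨w, hw⟩ _ hne
        rw [Pi.single_eq_of_ne]
        rintro rfl
        exact hne rfl
      · simp
    · rintro D - hD
      rw [Finset.sum_apply]
      refine sum_eq_zero ?_
      rintro ⟨w, rfl⟩ -
      rw [Pi.single_eq_of_ne]
      rintro rfl
      exact hD rfl
    · simp
  refine ⟨f, fun u v huv => ?_⟩
  have hv : v ∈ G.connectedComponentMk u :=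
    (ConnectedComponent.connectedComponentMk_eq_of_adj huv).symm
  rw [hval (G.connectedComponentMk u) ⟨u, rfl⟩, hval (G.connectedComponentMk u) ⟨v, hv⟩]
  exact (c _).valid huv

/-! ### The obstruction from a complete component. -/

/-- In a group of exponent two the weights on a connected component sum to zero. -/
lemma sum_weightedDegree_component (h2 : ∀ a : A, a + a = 0) (f : G.edgeSet → A)
    (C : G.ConnectedComponent) [Fintype C] : ∑ v : C, G.weightedDegree f v = 0 := by
  classical
  simp only [weightedDegree, sum_filter]
  -- Each edge contributes its label twice or not at all, as both ends lie in the same component.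
  rw [sum_comm]
  refine sum_eq_zero ?_
  rintro ⟨e, he⟩ -
  induction e using Sym2.ind with
  | _ x y =>
    have hxy : G.Adj x y := he
    have key : ∀ (a : A) (z : V), ∑ v : C, (if (v : V) = z then a else 0)
        = if z ∈ C.supp then a else 0 := fun a z => by
      split_ifs with hz
      · rw [sum_eq_single ⟨z, hz⟩]
        · simp
        · rintro ⟨v, hv⟩ _ hne
          exact if_neg fun h => hne (Subtype.ext h)
        · simp
      · refine sum_eq_zero fun v _ => if_neg ?_
        rintro rfl
        exact hz v.2
    have hsplit : ∀ (a : A) (v : V), (if v ∈ s(x, y) then a else 0)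
        = (if v = x then a else 0) + (if v = y then a else 0) := fun a v => by
      have := hxy.ne
      by_cases h1 : v = x
      · subst h1
        simp [this]
      · simp [h1]
    simp only [hsplit, sum_add_distrib, key, C.mem_supp_congr_adj hxy]
    exact h2 _

/-- An elementary abelian `2`-group of order `h` admits no vertex-colouring edge labelling of a
graph with a component `K_{h-2}`. -/
lemma not_isVertexColouring_of_completeGraph [Finite A] {q : ℕ} (e : A ≃+ (Fin q → ZMod 2))
    (C : G.ConnectedComponent)
    (hC : 3 ≤ C.supp.ncard)
    (φ : C.toSimpleGraph ≃g (⊤ : SimpleGraph (Fin (Nat.card A - 2)))) (f : G.edgeSet → A) :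
    ¬ G.IsVertexColouring f := by
  classical
  intro hf
  have := Fintype.ofFinite A
  have h2 := add_self_of_addEquiv e
  have hcard : Nat.card C = Nat.card A - 2 := by
    simpa using Nat.card_congr φ.toEquiv
  have hC' : 3 ≤ Nat.card C := hC
  have hq := card_eq_two_pow_of_addEquiv e
  -- The component has at least three vertices, so `|A| ≥ 5`.
  have h8 : 8 ∣ Nat.card A := by
    rw [hq]
    exact eight_dvd_two_pow (by rw [← hq]; omega)
  have hA := Nat.card_eq_fintype_card (α := A)
  rw [Nat.card_eq_fintype_card] at hcard hC'
  rw [hA] at hcard h8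
  have hinj : Function.Injective fun v : C => G.weightedDegree f v := fun u v huv => by
    by_contra hne
    have : C.toSimpleGraph.Adj u v := φ.map_adj_iff.1 (by simpa using hne)
    exact hf u v this huv
  have hS : ∑ a ∈ univ.image fun v : C => G.weightedDegree f v, a = 0 := by
    rw [sum_image fun u _ v _ h => hinj h]
    exact sum_weightedDegree_component h2 f C
  have hSc : #(univ.image fun v : C => G.weightedDegree f v)ᶜ = 2 := by
    rw [card_compl, card_image_of_injective _ hinj, card_univ]
    omega
  obtain ⟨x, y, hxy, hS'⟩ := card_eq_two.1 hSc
  have htot := sum_univ_eq_zero_of_add_self h2 ((by norm_num : 4 ∣ 8).trans h8)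
  rw [← sum_add_sum_compl (univ.image fun v : C => G.weightedDegree f v), hS, hS', sum_pair hxy,
    zero_add] at htot
  exact hxy (add_right_cancel (htot.trans (h2 y).symm))

end Realizable

/-! ### The group sum chromatic number and its colouring. -/

section GroupSumChromaticNumber

variable {V : Type*} [Fintype V] {G : SimpleGraph V}

/-- The set defining the group sum chromatic number is nonempty. -/
lemma exists_forall_exists_isVertexColouring
    (hG : ∀ C : G.ConnectedComponent, 3 ≤ C.supp.ncard) :
    ∃ s, 0 < s ∧ ∀ (A : Type) [AddCommGroup A], Nat.card A = s →
      ∃ f : G.edgeSet → A, G.IsVertexColouring f := by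
  -- An odd order rules out nontrivial elementary 2-groups.
  refine ⟨2 * Fintype.card V + 1, by omega, fun A _ hA => ?_⟩
  have : Finite A := Nat.finite_of_card_ne_zero (by omega)
  refine exists_isVertexColouring_of_colorable hG
    (G.colorable_of_fintype.mono (by omega)) ?_
  rintro ⟨⟨q, hq, ⟨e⟩⟩, -⟩
  have h1 := card_eq_two_pow_of_addEquiv e
  have h2 : 2 ∣ 2 ^ q := dvd_pow_self 2 (by omega)
  omega

lemma groupSumChromaticNumber_spec (hG : ∀ C : G.ConnectedComponent, 3 ≤ C.supp.ncard) :
    0 < G.groupSumChromaticNumber ∧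
      ∀ (A : Type) [AddCommGroup A], Nat.card A = G.groupSumChromaticNumber →
        ∃ f : G.edgeSet → A, G.IsVertexColouring f :=
  Nat.sInf_mem (exists_forall_exists_isVertexColouring hG)

lemma colorable_groupSumChromaticNumber (hG : ∀ C : G.ConnectedComponent, 3 ≤ C.supp.ncard) :
    G.Colorable G.groupSumChromaticNumber := by
  obtain ⟨hpos, hs⟩ := groupSumChromaticNumber_spec hG
  have : NeZero G.groupSumChromaticNumber := ⟨hpos.ne'⟩
  obtain ⟨f, hf⟩ := hs (ZMod G.groupSumChromaticNumber) (by simp)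
  have := (Coloring.mk (G.weightedDegree f) fun {u v} h => hf u v h).colorable
  rwa [ZMod.card] at this

lemma IsVertexColouring.map {A B : Type*} [AddCommGroup A] [AddCommGroup B] {f : G.edgeSet → A}
    (hf : G.IsVertexColouring f) (e : A ≃+ B) : G.IsVertexColouring (e ∘ f) := by
  have : ∀ v, G.weightedDegree (e ∘ f) v = e (G.weightedDegree f v) := fun v => by
    simp [weightedDegree, map_sum]
  intro u v h
  rw [this, this]
  exact e.injective.ne (hf u v h)

end GroupSumChromaticNumber

end SimpleGraph

theorem corollary3p1 {V : Type*} [Fintype V] (G : SimpleGraph V)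
    (hG : ∀ C : G.ConnectedComponent, 3 ≤ C.supp.ncard)
    (h : ℕ) (hh : G.groupSumChromaticNumber ≤ h)
    (A : Type*) [AddCommGroup A] [Finite A] (hA : Nat.card A = h) :
    (∃ f : G.edgeSet → A, G.IsVertexColouring f) ↔
      ¬ ((∃ q : ℕ, 1 ≤ q ∧ Nonempty (A ≃+ (Fin q → ZMod 2))) ∧
          ∃ C : G.ConnectedComponent,
            Nonempty (C.toSimpleGraph ≃g (⊤ : SimpleGraph (Fin (h - 2))))) := by
  subst hA
  constructor
  · rintro ⟨f, hf⟩ ⟨⟨q, -, ⟨e⟩⟩, C, ⟨φ⟩⟩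
    exact SimpleGraph.not_isVertexColouring_of_completeGraph e C (hG C) φ f hf
  · intro hex
    rcases hh.eq_or_lt with heq | hlt
    -- The definition only covers groups in `Type`, hence the passage through `Shrink`.
    · obtain ⟨f, hf⟩ := (SimpleGraph.groupSumChromaticNumber_spec hG).2 (Shrink.{0} A)
        (by rw [heq, Nat.card_congr (equivShrink.{0} A).symm])
      exact ⟨_, hf.map Shrink.addEquiv⟩
    · exact SimpleGraph.exists_isVertexColouring_of_colorable hG
        ((SimpleGraph.colorable_groupSumChromaticNumber hG).mono (by omega)) hex
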